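/- Let $G$ be a finite connected simple graph with at least two vertices, let $D=\operatorname{diam}(G)$, and let $P$ be a path of length $D$ (that is, with $D$ edges) in $G$ joining two vertices $a,b$ at distance $D$ from each other. Label the vertices of $P$ consecutively from $a$ to $b$ by integers $k$, starting from $0$ or from $1$ (the statement holds with either convention). Suppose that the vertices of $G$ not on $P$ are partitioned into vertex sets of graphs $G_{k,i}$, where $G_{k,i}$ is attached to the path vertex $k$ in the sense that every path in $G$ from a vertex of $G_{k,i}$ to a vertex outside $G_{k,i}$ passes through $k$ (any number of graphs, possibly none, may be attached to a given vertex $k$). For a vertex $v$ of $G_{k,i}$ let $\operatorname{hit}(v)$ be the expected number of steps that the simple random walk on $G$ started at $v$ (which in each step jumps to a uniformly random neighbour) needs to reach $P$, and let $\operatorname{hit}(G_{k,i})=\max_{v\in G_{k,i}}\operatorname{hit}(v)$. Assume that every attached graph $G_{k,i}$ satisfies $$|G_{k,i}|\le \frac{D}{32}\qquad\text{and}\qquad \operatorname{hit}(G_{k,i})\le\frac{1}{50}\min\{k,\,D-k\}^2 ,$$ where $|G_{k,i}|$ is the number of vertices of $G_{k,i}$ (the path vertex $k$ not included). Let $\lambda_2$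 be the second smallest eigenvalue, counted with multiplicity, of the graph Laplacian $L=\deg-A$ of $G$ (degree matrix minus adjacency matrix). Then every eigenvector $\phi_2\neq 0$ with $L\phi_2=\lambda_2\phi_2$ attains its maximum over all vertices of $G$ at one of the two endpoints $a,b$ of $P$, and its minimum at the other. -/

import Mathlib

open MeasureTheory ProbabilityTheory
open scoped ENNReal Matrix

namespace FiedlerPath

section Spectral

variable {V : Type*} [Fintype V] [DecidableEq V]

/-- The second smallest eigenvalue (with multiplicity) of the Laplacian `L = D - A`:
`eigenvalues₀` lists the eigenvalues in decreasing order, `λ_n ≥ ⋯ ≥ λ_2 ≥ λ_1`. -/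
noncomputable def lambda2 [Nontrivial V] (G : SimpleGraph V) [DecidableRel G.Adj] : ℝ :=
  (G.isHermitian_lapMatrix ℝ).eigenvalues₀
    ⟨Fintype.card V - 2, by have := Fintype.card_pos (α := V); omega⟩

/-- `φ` is a second eigenvector (Fiedler vector) of the graph Laplacian. -/
def IsFiedlerVector [Nontrivial V] (G : SimpleGraph V) [DecidableRel G.Adj] (φ : V → ℝ) : Prop :=
  φ ≠ 0 ∧ G.lapMatrix ℝ *ᵥ φ = lambda2 G • φ

end Spectral

section RandomWalk

variable {V : Type*} [Fintype V]

/-- One step of the simple random walk: a uniformly random neighbour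
(an isolated vertex is absorbing). -/
noncomputable def stepPMF (G : SimpleGraph V) [DecidableRel G.Adj] (v : V) : PMF V :=
  if h : (G.neighborFinset v).Nonempty then PMF.uniformOfFinset (G.neighborFinset v) h
  else PMF.pure v

/-- The transition kernel of the simple random walk. -/
noncomputable def stepKernel [MeasurableSpace V] [MeasurableSingletonClass V]
    (G : SimpleGraph V) [DecidableRel G.Adj] : Kernel V V :=
  Kernel.ofFunOfCountable fun v => (stepPMF G v).toMeasure

instance [MeasurableSpace V] [MeasurableSingletonClass V]
    (G : SimpleGraph V) [DecidableRel G.Adj] : IsMarkovKernel (stepKernel G) :=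
  ⟨fun v => inferInstanceAs (IsProbabilityMeasure (stepPMF G v).toMeasure)⟩

/-- The transition at time `n`, as a kernel on histories: it depends on the current position only. -/
noncomputable def historyKernel [MeasurableSpace V] [MeasurableSingletonClass V]
    (G : SimpleGraph V) [DecidableRel G.Adj] (n : ℕ) :
    Kernel ((i : Finset.Iic n) → (fun _ : ℕ => V) i) V :=
  (stepKernel G).comap (fun x => x ⟨n, Finset.mem_Iic.2 le_rfl⟩) (measurable_pi_apply _)

instance [MeasurableSpace V] [MeasurableSingletonClass V]
    (G : SimpleGraph V) [DecidableRel G.Adj] (n : ℕ) : IsMarkovKernel (historyKernel G n) := by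
  unfold historyKernel
  infer_instance

/-- The law, on trajectories `ℕ → V`, of the simple random walk on `G` started at `v`. -/
noncomputable def walkLaw [MeasurableSpace V] [MeasurableSingletonClass V]
    (G : SimpleGraph V) [DecidableRel G.Adj] (v : V) : Measure (ℕ → V) :=
  Kernel.trajMeasure (X := fun _ => V) (Measure.dirac v) (historyKernel G)

/-- The first time at which the trajectory `ω` is in `S` (`∞` if it never is). -/
noncomputable def hittingTime (S : Set V) (ω : ℕ → V) : ℝ≥0∞ :=
  ⨅ (n : ℕ) (_ : ω n ∈ S), (n : ℝ≥0∞)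

/-- The expected hitting time of `S` for the simple random walk started at `v`. -/
noncomputable def expectedHit (G : SimpleGraph V) [DecidableRel G.Adj] (S : Set V) (v : V) :
    ℝ≥0∞ :=
  letI : MeasurableSpace V := ⊤
  ∫⁻ ω, hittingTime S ω ∂(walkLaw G v)

/-- The maximal expected hitting time of `S` over all starting points in `B`. -/
noncomputable def maxHit (G : SimpleGraph V) [DecidableRel G.Adj] (S : Set V) (B : Finset V) :
    ℝ≥0∞ :=
  ⨆ v ∈ B, expectedHit G S v

end RandomWalk

/-- The sets `A k i` are the vertex sets of the graphs `G_{k,i}` attached to the path `p`, where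
`G_{k,i}` is attached at the `k`-th vertex `p.getVert k` of the path (counted from `0`): they
partition the vertices off the path, and any path from a vertex of `A k i` to a vertex outside
`A k i` passes through `p.getVert k`. -/
structure AttachedGraphs {V : Type*} (G : SimpleGraph V) {a b : V} (p : G.Walk a b)
    {ι : Fin (p.length + 1) → Type*} (A : ∀ k, ι k → Finset V) : Prop where
  off_path : ∀ k i, ∀ v ∈ A k i, v ∉ p.support
  cover : ∀ v, v ∉ p.support → ∃ k i, v ∈ A k i
  disjoint : Pairwise fun x y : (Σ k, ι k) => Disjoint (A x.1 x.2) (A y.1 y.2)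
  isolated : ∀ k i, ∀ v ∈ A k i, ∀ w, w ∉ A k i → ∀ q : G.Walk v w, q.IsPath →
    p.getVert k ∈ q.support

end FiedlerPath

namespace FiedlerPath

/-! ### The Laplacian's quadratic form and Courant–Fischer with its equality case. -/

section Laplacian

variable {V : Type*} [Fintype V] [DecidableEq V]

/-! Group each path vertex with the graphs attached to it into a cluster. Since the path is a
geodesic and attached graphs are left only through their path vertex, clusters communicate only
along path edges (`PathFibration`). Hence a function of the cluster index sees only path edges, and
summing Lf = λ₂f over the clusters 0, …, k gives f(k) - f(k+1) = λ₂ · (sum of f over those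
clusters).

Inside cluster k, the difference f(v) - f(k) is an expected sum of λ₂f/deg along the walk until it
hits the path, so it is at most λ₂ · max|f| · hit. Testing with a linear function of the index gives
λ₂ ≤ 12/((D+1)(D+2)). With the hitting time hypothesis this makes the relative deviation at most
1/2, and at most λ₂ times k(k+1)/2 and its mirror image (`OscillationBound`). So f has constant sign
on each cluster, and vanishes on a cluster once it vanishes at its path vertex.

A nodal domain argument then shows that f changes sign only once along the path
(`exists_sign_change`). If f(0) > 0, then f decreases along the nonnegative part, and iterating the
summed equation gives f(0) - f(k) ≥ λ₂ · k(k+1)/2 · f(k) wherever f(k) > 0. That is at least the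
possible excess of f over f(k) in cluster k, so the maximum is at 0 (`le_apply_zero`). Reversing the
path and negating f gives the minimum. -/

theorem lapMatrix_mulVec_eq_sum (G : SimpleGraph V) [DecidableRel G.Adj] (g : V → ℝ) (i : V) :
    (G.lapMatrix ℝ *ᵥ g) i = ∑ j, if G.Adj i j then g i - g j else 0 := by
  rw [SimpleGraph.lapMatrix_mulVec_apply, SimpleGraph.degree_eq_sum_if_adj,
    SimpleGraph.neighborFinset_eq_filter, Finset.sum_filter, Finset.sum_mul,
    ← Finset.sum_sub_distrib]
  refine Finset.sum_congr rfl fun j _ => ?_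
  split_ifs <;> ring

/-- The Dirichlet form of a graph. -/
theorem dotProduct_lapMatrix_mulVec (G : SimpleGraph V) [DecidableRel G.Adj] (f g : V → ℝ) :
    f ⬝ᵥ (G.lapMatrix ℝ *ᵥ g) =
      (∑ i, ∑ j, if G.Adj i j then (f i - f j) * (g i - g j) else 0) / 2 := by
  have h1 : f ⬝ᵥ (G.lapMatrix ℝ *ᵥ g) =
      ∑ i, ∑ j, if G.Adj i j then f i * (g i - g j) else 0 := by
    simp only [dotProduct, lapMatrix_mulVec_eq_sum, Finset.mul_sum, mul_ite, mul_zero]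
  have h2 : f ⬝ᵥ (G.lapMatrix ℝ *ᵥ g) =
      ∑ i, ∑ j, if G.Adj i j then -f j * (g i - g j) else 0 := by
    rw [h1, Finset.sum_comm]
    refine Finset.sum_congr rfl fun i _ => Finset.sum_congr rfl fun j _ => ?_
    rw [if_congr (G.adj_comm j i) rfl rfl]
    split_ifs <;> ring
  rw [eq_div_iff two_ne_zero, mul_two]
  nth_rw 1 [h1]
  rw [h2, ← Finset.sum_add_distrib]
  refine Finset.sum_congr rfl fun i _ => ?_
  rw [← Finset.sum_add_distrib]
  refine Finset.sum_congr rfl fun j _ => ?_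
  split_ifs <;> ring

/-- Courant–Fischer on a two-dimensional span, for the second smallest eigenvalue of a real
symmetric matrix, together with the equality case. -/
theorem exists_combination_eigenvalue_le {A : Matrix V V ℝ} (hA : A.IsHermitian)
    (i₀ : Fin (Fintype.card V)) (hi₀ : (i₀ : ℕ) = Fintype.card V - 2) (f g : V → ℝ) :
    ∃ α β : ℝ, (α ≠ 0 ∨ β ≠ 0) ∧ ∀ h : V → ℝ, h = α • f + β • g →
      hA.eigenvalues₀ i₀ * (h ⬝ᵥ h) ≤ h ⬝ᵥ (A *ᵥ h) ∧
      (h ⬝ᵥ (A *ᵥ h) ≤ hA.eigenvalues₀ i₀ * (h ⬝ᵥ h) → A *ᵥ h = hA.eigenvalues₀ i₀ • h) := by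
  set μ := hA.eigenvalues₀ i₀
  let e : Fin (Fintype.card V) ≃ V := Fintype.equivOfCardEq (Fintype.card_fin _)
  have hpos : 0 < Fintype.card V := i₀.pos
  -- Eigenvalues are listed decreasingly, so the last index carries the smallest one, and every
  -- other eigenvalue is at least `μ`.
  let v₀ : V := e ⟨Fintype.card V - 1, by omega⟩
  have hμ : ∀ j, j ≠ v₀ → μ ≤ hA.eigenvalues j := by
    intro j hj
    refine hA.eigenvalues₀_antitone ?_
    rw [Fin.le_def, hi₀]
    by_contra hlt
    apply hj
    have : e.symm j = ⟨Fintype.card V - 1, by omega⟩ := by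
      apply Fin.ext
      have h1 := (e.symm j).isLt
      change ¬ ((e.symm j : Fin _) : ℕ) ≤ _ at hlt
      simp only
      omega
    rw [← e.apply_symm_apply j, this]
  let b := hA.eigenvectorBasis
  let cf : (V → ℝ) → V → ℝ := fun x j => ∑ i, b j i * x i
  have hcf : ∀ x j, b.repr (WithLp.toLp 2 x) j = cf x j := by
    intro x j
    rw [OrthonormalBasis.repr_apply_apply, PiLp.inner_apply]
    simp [cf, mul_comm]
  have hcfA : ∀ x j, cf (A *ᵥ x) j = hA.eigenvalues j * cf x j := by
    intro x j
    have h1 : cf (A *ᵥ x) j = (⇑(b j)) ⬝ᵥ (A *ᵥ x) := rfl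
    have hT : Aᵀ = A := by simpa using hA.eq
    rw [h1, Matrix.dotProduct_mulVec, ← Matrix.mulVec_transpose, hT,
      hA.mulVec_eigenvectorBasis j, smul_dotProduct]
    rfl
  have hdot : ∀ x y : V → ℝ, x ⬝ᵥ y = ∑ j, cf x j * cf y j := by
    intro x y
    have h1 := b.repr.inner_map_map (WithLp.toLp 2 x) (WithLp.toLp 2 y)
    rw [PiLp.inner_apply, PiLp.inner_apply] at h1
    simp only [hcf] at h1
    simp only [dotProduct]
    calc ∑ i, x i * y i = ∑ i, inner ℝ (x i) (y i) := by simp [mul_comm]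
      _ = ∑ i, inner ℝ (cf x i) (cf y i) := h1.symm
      _ = _ := by simp [mul_comm]
  have hinj : ∀ x y : V → ℝ, (∀ j, cf x j = cf y j) → x = y := by
    intro x y hxy
    have : WithLp.toLp 2 x = WithLp.toLp 2 y := by
      apply b.repr.injective
      ext j
      rw [hcf, hcf, hxy]
    exact (WithLp.toLp_injective 2) this
  have hlin : ∀ (α β : ℝ) j, cf (α • f + β • g) j = α * cf f j + β * cf g j := by
    intro α β j
    simp only [cf, Finset.mul_sum, ← Finset.sum_add_distrib, Pi.add_apply, Pi.smul_apply,
      smul_eq_mul]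
    exact Finset.sum_congr rfl fun i _ => by ring
  -- Two free coefficients and one linear condition: orthogonality to the bottom eigenvector.
  obtain ⟨α, β, hne, hv₀⟩ : ∃ α β : ℝ, (α ≠ 0 ∨ β ≠ 0) ∧ α * cf f v₀ + β * cf g v₀ = 0 := by
    by_cases h0 : cf f v₀ = 0
    · exact ⟨1, 0, Or.inl one_ne_zero, by simp [h0]⟩
    · exact ⟨-cf g v₀, cf f v₀, Or.inr h0, by ring⟩
  refine ⟨α, β, hne, fun h hh => ?_⟩
  have hh0 : cf h v₀ = 0 := by rw [hh, hlin, hv₀]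
  have hterm : ∀ j, 0 ≤ (hA.eigenvalues j - μ) * (cf h j * cf h j) := by
    intro j
    by_cases hj : j = v₀
    · rw [hj, hh0]; simp
    · exact mul_nonneg (sub_nonneg.2 (hμ j hj)) (mul_self_nonneg _)
  have hdiff : h ⬝ᵥ (A *ᵥ h) - μ * (h ⬝ᵥ h) =
      ∑ j, (hA.eigenvalues j - μ) * (cf h j * cf h j) := by
    rw [hdot, hdot, Finset.mul_sum, ← Finset.sum_sub_distrib]
    refine Finset.sum_congr rfl fun j _ => ?_
    rw [hcfA]; ring
  have hnn := Finset.sum_nonneg fun j (_ : j ∈ Finset.univ) => hterm j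
  refine ⟨by linarith, fun heq => hinj _ _ fun j => ?_⟩
  have h0 := (Finset.sum_eq_zero_iff_of_nonneg fun j (_ : j ∈ Finset.univ) => hterm j).1
    (by linarith) j (Finset.mem_univ j)
  have h2 : cf (μ • h) j = μ * cf h j := by
    simp only [cf, Finset.mul_sum, Pi.smul_apply, smul_eq_mul]
    exact Finset.sum_congr rfl fun i _ => by ring
  rw [hcfA, h2]
  rcases mul_eq_zero.1 h0 with h1 | h1
  · rw [sub_eq_zero.1 h1]
  · rw [mul_self_eq_zero.1 h1, mul_zero, mul_zero]

theorem lambda2_nonneg [Nontrivial V] (G : SimpleGraph V) [DecidableRel G.Adj] :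
    0 ≤ lambda2 G := by
  obtain ⟨j, hj⟩ : ∃ j, (G.isHermitian_lapMatrix ℝ).eigenvalues j = lambda2 G :=
    ⟨(Fintype.equivOfCardEq (Fintype.card_fin _))
      ⟨Fintype.card V - 2, by have := Fintype.card_pos (α := V); omega⟩, by
        simp [Matrix.IsHermitian.eigenvalues, lambda2]⟩
  rw [← hj]
  exact (G.posSemidef_lapMatrix ℝ).eigenvalues_nonneg j

end Laplacian

/-! ### Functions and eigenfunctions on a graph fibred over a path. -/

section Fibration

variable {V : Type*}

/-- The graph `G` is fibred over a path with vertices `pos 0, …, pos D`: the map `c` sends each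
vertex to the index of its cluster, and different clusters are joined only by the path edges. -/
structure PathFibration (G : SimpleGraph V) (D : ℕ) (pos : ℕ → V) (c : V → ℕ) : Prop where
  proj_pos : ∀ k ≤ D, c (pos k) = k
  proj_le : ∀ v, c v ≤ D
  adj : ∀ u w, G.Adj u w → c u = c w ∨
    (u = pos (c u) ∧ w = pos (c w) ∧ (c w = c u + 1 ∨ c u = c w + 1))
  adj_succ : ∀ k < D, G.Adj (pos k) (pos (k + 1))

/-- On each cluster, `f` deviates little from its value at the path vertex of the cluster. -/
def OscillationBound (D : ℕ) (pos : ℕ → V) (c : V → ℕ) (μ : ℝ) (f : V → ℝ) : Prop :=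
  ∀ v, ∃ w : ℝ, |f v - f (pos (c v))| ≤ w * |f (pos (c v))| ∧ w ≤ 1 / 2 ∧
    w ≤ μ * ((c v : ℝ) * (c v + 1) / 2) ∧
    w ≤ μ * (((D : ℝ) - c v) * ((D : ℝ) - c v + 1) / 2)

variable {G : SimpleGraph V} {D : ℕ} {pos : ℕ → V} {c : V → ℕ} {μ : ℝ} {f : V → ℝ}

theorem PathFibration.reverse (hF : PathFibration G D pos c) :
    PathFibration G D (fun k => pos (D - k)) (fun v => D - c v) where
  proj_pos k hk := by simp only [hF.proj_pos (D - k) (Nat.sub_le _ _)]; omega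
  proj_le v := Nat.sub_le _ _
  adj u w h := by
    have hu := hF.proj_le u
    have hw := hF.proj_le w
    have hu' : D - (D - c u) = c u := by omega
    have hw' : D - (D - c w) = c w := by omega
    simp only [hu', hw']
    rcases hF.adj u w h with h1 | ⟨h1, h2, h3⟩
    · left; rw [h1]
    · exact Or.inr ⟨h1, h2, by omega⟩
  adj_succ k hk := by
    have h := hF.adj_succ (D - (k + 1)) (by omega)
    rw [show D - (k + 1) + 1 = D - k by omega] at h
    exact h.symm

theorem OscillationBound.reverse (hF : PathFibration G D pos c)
    (h : OscillationBound D pos c μ f) :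
    OscillationBound D (fun k => pos (D - k)) (fun v => D - c v) μ f := by
  intro v
  obtain ⟨w, h1, h2, h3, h4⟩ := h v
  have hv := hF.proj_le v
  have hv' : D - (D - c v) = c v := by omega
  simp only [hv', Nat.cast_sub hv]
  exact ⟨w, h1, h2, h4, by simpa using h3⟩

theorem OscillationBound.eq_zero (h : OscillationBound D pos c μ f) {v : V}
    (hv : f (pos (c v)) = 0) : f v = 0 := by
  obtain ⟨w, h1, -⟩ := h v
  simpa [hv] using h1

theorem OscillationBound.half_le (h : OscillationBound D pos c μ f) (v : V) :
    |f v - f (pos (c v))| ≤ 1 / 2 * |f (pos (c v))| := by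
  obtain ⟨w, h1, h2, -⟩ := h v
  exact h1.trans (mul_le_mul_of_nonneg_right h2 (abs_nonneg _))

theorem OscillationBound.nonneg (h : OscillationBound D pos c μ f) {v : V}
    (hv : 0 ≤ f (pos (c v))) : 0 ≤ f v := by
  have h1 := abs_le.1 (h.half_le v)
  rw [abs_of_nonneg hv] at h1
  linarith [h1.1]

theorem OscillationBound.nonpos (h : OscillationBound D pos c μ f) {v : V}
    (hv : f (pos (c v)) ≤ 0) : f v ≤ 0 := by
  have h1 := abs_le.1 (h.half_le v)
  rw [abs_of_nonpos hv] at h1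
  linarith [h1.2]

variable [Fintype V] [DecidableEq V] [DecidableRel G.Adj]

/-- A sum over oriented edges that only sees edges between different clusters is a sum over the
path edges. -/
theorem PathFibration.sum_edges (hF : PathFibration G D pos c) (F : V → V → ℝ)
    (hsymm : ∀ u w, F u w = F w u) (hzero : ∀ u w, c u = c w → F u w = 0) :
    (∑ u, ∑ w, if G.Adj u w then F u w else 0) / 2 =
      ∑ k ∈ Finset.range D, F (pos k) (pos (k + 1)) := by
  have hsplit : ∀ u w, (if G.Adj u w then F u w else 0) =
      (if G.Adj u w ∧ c w = c u + 1 then F u w else 0) +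
        (if G.Adj w u ∧ c u = c w + 1 then F w u else 0) := by
    intro u w
    by_cases h : G.Adj u w
    · rcases hF.adj u w h with h1 | ⟨-, -, h1 | h1⟩
      · simp [h1, hzero u w h1]
      · simp [h, h1]
        omega
      · simp [h, h.symm, h1, hsymm u w]
        omega
    · have h' : ¬ G.Adj w u := fun h' => h h'.symm
      simp [h, h']
  have hhalf : (∑ u, ∑ w, if G.Adj u w then F u w else 0) / 2 =
      ∑ u, ∑ w, if G.Adj u w ∧ c w = c u + 1 then F u w else 0 := by
    simp only [hsplit, Finset.sum_add_distrib]
    rw [Finset.sum_comm (f := fun u w => if G.Adj w u ∧ c u = c w + 1 then F w u else 0)]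
    ring
  rw [hhalf, ← Finset.sum_product', ← Finset.sum_filter]
  refine (Finset.sum_bij' (fun k _ => (pos k, pos (k + 1))) (fun q _ => c q.1) ?_ ?_ ?_ ?_ ?_).symm
  · intro k hk
    rw [Finset.mem_range] at hk
    simp [hF.adj_succ k hk, hF.proj_pos k hk.le, hF.proj_pos (k + 1) hk]
  · rintro ⟨u, w⟩ h
    simp only [Finset.mem_filter] at h
    have := hF.proj_le w
    rw [Finset.mem_range]
    simp only
    omega
  · intro k hk
    rw [Finset.mem_range] at hk
    exact hF.proj_pos k hk.le
  · rintro ⟨u, w⟩ h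
    simp only [Finset.mem_filter] at h
    rcases hF.adj u w h.2.1 with h1 | ⟨h1, h2, -⟩
    · omega
    · rw [h.2.2] at h2
      simp only [Prod.mk.injEq]
      exact ⟨h1.symm, h2.symm⟩
  · intro k _
    rfl

theorem PathFibration.dotProduct_lapMatrix (hF : PathFibration G D pos c) (Y : ℕ → ℝ)
    (f : V → ℝ) : (fun v => Y (c v)) ⬝ᵥ (G.lapMatrix ℝ *ᵥ f) =
      ∑ k ∈ Finset.range D, (Y k - Y (k + 1)) * (f (pos k) - f (pos (k + 1))) := by
  rw [dotProduct_lapMatrix_mulVec, hF.sum_edges (fun u w => (Y (c u) - Y (c w)) * (f u - f w))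
    (fun u w => by ring) (fun u w h => by rw [h]; ring)]
  refine Finset.sum_congr rfl fun k hk => ?_
  rw [Finset.mem_range] at hk
  rw [hF.proj_pos k hk.le, hF.proj_pos (k + 1) hk]

/-- The Dirichlet energy of an eigenfunction rescaled along the path. -/
theorem PathFibration.energy_rescale (hF : PathFibration G D pos c)
    (hf : G.lapMatrix ℝ *ᵥ f = μ • f) (Y : ℕ → ℝ) :
    (fun v => Y (c v) * f v) ⬝ᵥ (G.lapMatrix ℝ *ᵥ fun v => Y (c v) * f v) =
      μ * ((fun v => Y (c v) * f v) ⬝ᵥ fun v => Y (c v) * f v) +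
      ∑ k ∈ Finset.range D, f (pos k) * f (pos (k + 1)) * (Y k - Y (k + 1)) ^ 2 := by
  have h1 : (fun v => Y (c v) ^ 2 * f v) ⬝ᵥ (G.lapMatrix ℝ *ᵥ f) =
      μ * ((fun v => Y (c v) * f v) ⬝ᵥ fun v => Y (c v) * f v) := by
    rw [hf, dotProduct_smul, smul_eq_mul]
    congr 1
    exact Finset.sum_congr rfl fun v _ => by ring
  have h2 := hF.sum_edges (fun u w => f u * f w * (Y (c u) - Y (c w)) ^ 2)
    (fun u w => by ring) (fun u w h => by rw [h]; ring)
  have h3 : ∑ k ∈ Finset.range D, f (pos k) * f (pos (k + 1)) * (Y k - Y (k + 1)) ^ 2 =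
      (∑ u, ∑ w, if G.Adj u w then f u * f w * (Y (c u) - Y (c w)) ^ 2 else 0) / 2 := by
    rw [h2]
    refine Finset.sum_congr rfl fun k hk => ?_
    rw [Finset.mem_range] at hk
    rw [hF.proj_pos k hk.le, hF.proj_pos (k + 1) hk]
  rw [h3, ← h1, dotProduct_lapMatrix_mulVec, dotProduct_lapMatrix_mulVec, ← add_div,
    ← Finset.sum_add_distrib]
  congr 1
  refine Finset.sum_congr rfl fun u _ => ?_
  rw [← Finset.sum_add_distrib]
  refine Finset.sum_congr rfl fun w _ => ?_
  -- With y, z the values of `Y` at u, w: (y f(u) - z f(w))² = (y² f(u) - z² f(w))(f(u) - f(w)) +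
  -- f(u) f(w) (y - z)².
  split_ifs <;> ring

/-- Summing the eigenvalue equation over an initial segment of clusters. -/
theorem PathFibration.eigenvalue_mul_sum (hF : PathFibration G D pos c)
    (hf : G.lapMatrix ℝ *ᵥ f = μ • f) {k : ℕ} (hk : k < D) :
    μ * (∑ v, if c v ≤ k then f v else 0) = f (pos k) - f (pos (k + 1)) := by
  have h := hF.dotProduct_lapMatrix (fun j => if j ≤ k then 1 else 0) f
  rw [hf, dotProduct_smul, smul_eq_mul] at h
  simp only [dotProduct, ite_mul, one_mul, zero_mul] at h
  rw [h, Finset.sum_eq_single k]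
  · simp
  · intro j _ hj
    rcases lt_or_gt_of_ne hj with h1 | h1
    · rw [if_pos (by omega), if_pos (by omega)]; ring
    · rw [if_neg (by omega), if_neg (by omega)]; ring
  · intro h1
    exact absurd (Finset.mem_range.2 hk) h1

theorem PathFibration.sum_eq_zero (hF : PathFibration G D pos c)
    (hf : G.lapMatrix ℝ *ᵥ f = μ • f) (hμ : μ ≠ 0) : ∑ v, f v = 0 := by
  have h := hF.dotProduct_lapMatrix (fun _ => 1) f
  rw [hf, dotProduct_smul, smul_eq_mul] at h
  simpa [dotProduct, hμ] using h

/-- Unique continuation: if f vanishes on clusters 0, …, k, the summed equation gives f(k+1) = f(k)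
= 0, and the relative oscillation bound clears the whole next cluster. -/
theorem PathFibration.eq_zero_of_apply_zero (hF : PathFibration G D pos c)
    (hf : G.lapMatrix ℝ *ᵥ f = μ • f) (hosc : OscillationBound D pos c μ f)
    (h0 : f (pos 0) = 0) : f = 0 := by
  have key : ∀ k, k ≤ D → f (pos k) = 0 := by
    intro k
    induction k using Nat.strong_induction_on with
    | _ k ih =>
      intro hk
      rcases k with _ | k
      · exact h0
      · have h1 := hF.eigenvalue_mul_sum hf (k := k) (by omega)
        rw [Finset.sum_eq_zero, ih k (by omega) (by omega)] at h1
        · linarith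
        · intro v _
          split_ifs with hv
          · exact hosc.eq_zero (ih _ (by omega) (hF.proj_le v))
          · rfl
  funext v
  exact hosc.eq_zero (key _ (hF.proj_le v))

theorem PathFibration.eq_zero_of_apply_last (hF : PathFibration G D pos c)
    (hf : G.lapMatrix ℝ *ᵥ f = μ • f) (hosc : OscillationBound D pos c μ f)
    (h0 : f (pos D) = 0) : f = 0 :=
  hF.reverse.eq_zero_of_apply_zero hf (hosc.reverse hF) (by simpa using h0)

/-! ### The second eigenvalue: upper bound, sign change and extrema. -/

variable [Nontrivial V]

/-- Comparison with a linear function along the path. -/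
theorem PathFibration.lambda2_le (hF : PathFibration G D pos c) (hD : 0 < D) :
    lambda2 G * ((D + 1) * (D + 2)) ≤ 12 := by
  -- Centring at D/2 makes constants and the linear function orthogonal over the path vertices, so
  -- no cross term survives in `hnorm`.
  obtain ⟨α, β, hne, h⟩ := exists_combination_eigenvalue_le (G.isHermitian_lapMatrix ℝ)
    ⟨Fintype.card V - 2, by have := Fintype.card_pos (α := V); omega⟩ rfl
    (fun _ => (1 : ℝ)) (fun v => (c v : ℝ) - D / 2)
  have h1 := (h (fun v => α + β * ((c v : ℝ) - D / 2)) (by ext v; simp)).1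
  change lambda2 G * _ ≤ _ at h1
  have hμ := lambda2_nonneg G
  have hD' : (0 : ℝ) < D := by exact_mod_cast hD
  rw [hF.dotProduct_lapMatrix (fun k => α + β * ((k : ℝ) - D / 2))] at h1
  have hen : ∑ k ∈ Finset.range D, ((α + β * ((k : ℝ) - D / 2)) -
      (α + β * (((k + 1 : ℕ) : ℝ) - D / 2))) * ((α + β * ((c (pos k) : ℝ) - D / 2)) -
      (α + β * ((c (pos (k + 1)) : ℝ) - D / 2))) = D * β ^ 2 := by
    rw [Finset.sum_congr rfl (g := fun _ => β ^ 2)]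
    · simp
    · intro k hk
      rw [Finset.mem_range] at hk
      rw [hF.proj_pos k hk.le, hF.proj_pos (k + 1) hk]
      push_cast
      ring
  rw [hen] at h1
  have hsum : ∀ n : ℕ, ∑ k ∈ Finset.range (n + 1), (α + β * ((k : ℝ) - D / 2)) ^ 2 =
      (n + 1) * (α - β * D / 2) ^ 2 + (α - β * D / 2) * β * (n * (n + 1)) +
        β ^ 2 * (n * (n + 1) * (2 * n + 1) / 6) := by
    intro n
    induction n with
    | zero => simp; ring
    | succ n ih => rw [Finset.sum_range_succ, ih]; push_cast; ring
  have hnorm : (D + 1) * α ^ 2 + β ^ 2 * (D * (D + 1) * (D + 2) / 12) ≤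
      (fun v => α + β * ((c v : ℝ) - D / 2)) ⬝ᵥ fun v => α + β * ((c v : ℝ) - D / 2) := by
    have hinj : Set.InjOn pos (Finset.range (D + 1)) := by
      intro i hi j hj hij
      simp only [Finset.coe_range, Set.mem_Iio] at hi hj
      rw [← hF.proj_pos i (by omega), ← hF.proj_pos j (by omega), hij]
    calc _ = ∑ k ∈ Finset.range (D + 1), (α + β * ((k : ℝ) - D / 2)) ^ 2 := by
          rw [hsum]; ring
      _ = ∑ k ∈ Finset.range (D + 1), (α + β * ((c (pos k) : ℝ) - D / 2)) ^ 2 := by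
          refine Finset.sum_congr rfl fun k hk => ?_
          rw [Finset.mem_range] at hk
          rw [hF.proj_pos k (by omega)]
      _ = ∑ v ∈ (Finset.range (D + 1)).image pos, (α + β * ((c v : ℝ) - D / 2)) ^ 2 :=
          (Finset.sum_image (f := fun v => (α + β * ((c v : ℝ) - D / 2)) ^ 2) hinj).symm
      _ ≤ ∑ v, (α + β * ((c v : ℝ) - D / 2)) ^ 2 :=
          Finset.sum_le_sum_of_subset_of_nonneg (Finset.subset_univ _)
            fun _ _ _ => sq_nonneg _
      _ = _ := Finset.sum_congr rfl fun v _ => by ring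
  have h2 := (mul_le_mul_of_nonneg_left hnorm hμ).trans h1
  by_cases hβ : β = 0
  · have hα : α ≠ 0 := hne.resolve_right (not_not.2 hβ)
    have hα2 : 0 < (D + 1) * α ^ 2 := by positivity
    rw [hβ] at h2
    have h3 : lambda2 G * ((D + 1) * α ^ 2) ≤ 0 := by simpa using h2
    have h4 : lambda2 G ≤ 0 := by
      by_contra h5
      exact absurd h3 (not_le.2 (mul_pos (not_le.1 h5) hα2))
    rw [le_antisymm h4 hμ]
    norm_num
  · have hβ2 : 0 < D * β ^ 2 := by positivity
    have h3 : 0 ≤ lambda2 G * ((D + 1) * α ^ 2) := by positivity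
    refine le_of_mul_le_mul_right ?_ hβ2
    linarith

/-- An eigenfunction of the second smallest eigenvalue changes sign exactly once along the
path. -/
theorem PathFibration.exists_sign_change (hF : PathFibration G D pos c)
    (hosc : ∀ g : V → ℝ, G.lapMatrix ℝ *ᵥ g = lambda2 G • g →
      OscillationBound D pos c (lambda2 G) g)
    (hμ : lambda2 G ≠ 0) (hf : G.lapMatrix ℝ *ᵥ f = lambda2 G • f) (h0 : 0 < f (pos 0)) :
    ∃ i, i ≤ D ∧ (∀ k < i, 0 ≤ f (pos k)) ∧ ∀ k, i ≤ k → k ≤ D → f (pos k) < 0 := by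
  have hex : ∃ i, i ≤ D ∧ f (pos i) < 0 := by
    by_contra! hcon
    have hnn : ∀ v, 0 ≤ f v := fun v => (hosc f hf).nonneg (hcon _ (hF.proj_le v))
    have := (Finset.sum_eq_zero_iff_of_nonneg fun v _ => hnn v).1 (hF.sum_eq_zero hf hμ)
      (pos 0) (Finset.mem_univ _)
    exact h0.ne' this
  classical
  obtain ⟨i, ⟨hiD, hineg⟩, hmin⟩ : ∃ i, (i ≤ D ∧ f (pos i) < 0) ∧
      ∀ k < i, ¬ (k ≤ D ∧ f (pos k) < 0) :=
    ⟨Nat.find hex, Nat.find_spec hex, fun k hk => Nat.find_min hex hk⟩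
  have hbefore : ∀ k < i, 0 ≤ f (pos k) := fun k hk =>
    not_lt.1 fun h => hmin k hk ⟨by omega, h⟩
  refine ⟨i, hiD, hbefore, ?_⟩
  by_contra! hcon
  obtain ⟨j, ⟨hij, hjD, hjpos⟩, hjmin⟩ : ∃ j, (i ≤ j ∧ j ≤ D ∧ 0 ≤ f (pos j)) ∧
      ∀ k < j, ¬ (i ≤ k ∧ k ≤ D ∧ 0 ≤ f (pos k)) :=
    ⟨Nat.find hcon, Nat.find_spec hcon, fun k hk => Nat.find_min hcon hk⟩
  have hmid : ∀ k, i ≤ k → k < j → f (pos k) < 0 := fun k h1 h2 =>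
    not_le.1 fun h => hjmin k h2 ⟨h1, by omega, h⟩
  have hi0 : 0 < i := Nat.pos_of_ne_zero fun h => by
    rw [h] at hineg; exact absurd h0 (not_lt.2 hineg.le)
  have hij' : i < j := lt_of_le_of_ne hij fun h => by
    rw [← h] at hjpos; exact absurd hineg (not_lt.2 hjpos)
  obtain ⟨α, β, hne, h⟩ := exists_combination_eigenvalue_le (G.isHermitian_lapMatrix ℝ)
    ⟨Fintype.card V - 2, by have := Fintype.card_pos (α := V); omega⟩ rfl
    (fun v => if c v < i then f v else 0) (fun v => if i ≤ c v ∧ c v < j then f v else 0)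
  -- Suppose f returns to a nonnegative value at `j`. Rescale f by α on the clusters before `i`, by
  -- β on those from `i` to `j`, and by 0 from `j` on.
  set Y : ℕ → ℝ := fun k => if k < i then α else if k < j then β else 0 with hY
  obtain ⟨-, h2⟩ := h (fun v => Y (c v) * f v) (by
    ext v
    simp only [hY, Pi.add_apply, Pi.smul_apply, smul_eq_mul]
    by_cases h1 : c v < i
    · simp [h1, not_le.2 h1]
    · by_cases h2 : c v < j
      · simp [h1, h2, not_lt.1 h1]
      · simp [h1, h2])
  -- `Y` jumps only across the edges into `i` and `j`, where consecutive values of f have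
  -- nonpositive product.
  have hle : ∑ k ∈ Finset.range D, f (pos k) * f (pos (k + 1)) * (Y k - Y (k + 1)) ^ 2 ≤ 0 := by
    refine Finset.sum_nonpos fun k _ => ?_
    by_cases h1 : k + 1 = i
    · refine mul_nonpos_of_nonpos_of_nonneg (mul_nonpos_of_nonneg_of_nonpos
        (hbefore k (by omega)) ?_) (sq_nonneg _)
      rw [h1]; exact hineg.le
    · by_cases h2 : k + 1 = j
      · refine mul_nonpos_of_nonpos_of_nonneg (mul_nonpos_of_nonpos_of_nonneg
          (hmid k (by omega) (by omega)).le ?_) (sq_nonneg _)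
        rw [h2]; exact hjpos
      · have : Y k = Y (k + 1) := by
          simp only [hY]
          rw [if_congr (show k < i ↔ k + 1 < i by omega) rfl
            (if_congr (show k < j ↔ k + 1 < j by omega) rfl rfl)]
        rw [this]; simp
  have heig := h2 (by
    rw [hF.energy_rescale hf Y]
    change lambda2 G * _ + _ ≤ lambda2 G * _
    linarith)
  -- The Rayleigh quotient is at most λ₂, so the rescaled function is itself an eigenvector; it
  -- vanishes at the last vertex, hence everywhere. This is why the oscillation bound is assumed for
  -- all eigenvectors.
  have hvan := hF.eq_zero_of_apply_last heig (hosc _ heig) (by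
    simp only [hY]
    rw [hF.proj_pos D le_rfl, if_neg (by omega), if_neg (by omega), zero_mul])
  rcases hne with hα | hβ
  · have h3 := congrFun hvan (pos 0)
    simp only [hY, hF.proj_pos 0 (Nat.zero_le _), if_pos hi0] at h3
    exact (mul_ne_zero hα h0.ne') h3
  · have h3 := congrFun hvan (pos i)
    simp only [hY, hF.proj_pos i hiD, lt_irrefl, if_false, if_pos hij'] at h3
    exact (mul_ne_zero hβ hineg.ne) h3

/-- A second eigenfunction that is positive at the first path vertex is maximal there, and is
negative at the last one. -/
theorem PathFibration.le_apply_zero (hF : PathFibration G D pos c)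
    (hosc : ∀ g : V → ℝ, G.lapMatrix ℝ *ᵥ g = lambda2 G • g →
      OscillationBound D pos c (lambda2 G) g)
    (hμ : lambda2 G ≠ 0) (hf : G.lapMatrix ℝ *ᵥ f = lambda2 G • f) (h0 : 0 < f (pos 0)) :
    (∀ v, f v ≤ f (pos 0)) ∧ f (pos D) < 0 := by
  obtain ⟨i, hiD, hpos, hneg⟩ := hF.exists_sign_change hosc hμ hf h0
  refine ⟨fun v => ?_, hneg D hiD le_rfl⟩
  have hf' := hosc f hf
  have hμ0 := lambda2_nonneg G
  by_cases hxv : f (pos (c v)) ≤ 0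
  · exact (hf'.nonpos hxv).trans h0.le
  push Not at hxv
  have hvi : c v < i := by
    by_contra hcon
    exact absurd (hneg _ (not_lt.1 hcon) (hF.proj_le v)) (not_lt.2 hxv.le)
  have hsum : ∀ j < i, ∑ l ∈ Finset.range (j + 1), f (pos l) ≤
      ∑ v, if c v ≤ j then f v else 0 := by
    intro j hj
    have hinj : Set.InjOn pos (Finset.range (j + 1)) := by
      intro i hi j hj hij
      simp only [Finset.coe_range, Set.mem_Iio] at hi hj
      rw [← hF.proj_pos i (by omega), ← hF.proj_pos j (by omega), hij]
    rw [← Finset.sum_filter, ← Finset.sum_image (f := f) hinj]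
    refine Finset.sum_le_sum_of_subset_of_nonneg ?_ ?_
    · intro u hu
      obtain ⟨l, hl, rfl⟩ := Finset.mem_image.1 hu
      rw [Finset.mem_range] at hl
      rw [Finset.mem_filter, hF.proj_pos l (by omega)]
      exact ⟨Finset.mem_univ _, by omega⟩
    · intro u hu _
      exact hf'.nonneg (hpos _ (lt_of_le_of_lt (Finset.mem_filter.1 hu).2 hj))
  have hstep : ∀ j, j + 1 < i → f (pos (j + 1)) ≤ f (pos j) := by
    intro j hj
    have h1 := hF.eigenvalue_mul_sum hf (k := j) (by omega)
    have h2 : 0 ≤ ∑ v, if c v ≤ j then f v else 0 :=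
      (Finset.sum_nonneg fun l hl => hpos l (by rw [Finset.mem_range] at hl; omega)).trans
        (hsum j (by omega))
    nlinarith [mul_nonneg hμ0 h2]
  have hanti : ∀ k, k < i → ∀ l ≤ k, f (pos k) ≤ f (pos l) := by
    intro k
    induction k with
    | zero => intro _ l hl; rw [Nat.le_zero.1 hl]
    | succ k ih =>
      intro hk l hl
      rcases Nat.lt_or_ge l (k + 1) with h1 | h1
      · exact (hstep k hk).trans (ih (by omega) l (by omega))
      · rw [le_antisymm hl h1]
  -- By monotonicity each of the n+1 path values in the summed equation is at least f at `pos (c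
  -- v)`, so the drops add up to 1 + 2 + … + n = n(n+1)/2 multiples of it.
  have hgrow : ∀ n ≤ c v, f (pos n) + lambda2 G * (n * (n + 1) / 2) * f (pos (c v)) ≤
      f (pos 0) := by
    intro n
    induction n with
    | zero => simp
    | succ n ih =>
      intro hn
      have h1 := ih (by omega)
      have h2 := hF.eigenvalue_mul_sum hf (k := n) (by have := hF.proj_le v; omega)
      have h3 : ((n : ℝ) + 1) * f (pos (c v)) ≤ ∑ v, if c v ≤ n then f v else 0 := by
        refine le_trans ?_ (hsum n (by omega))
        have := Finset.card_nsmul_le_sum (Finset.range (n + 1)) (fun l => f (pos l))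
          (f (pos (c v))) fun l hl => hanti _ hvi l (by rw [Finset.mem_range] at hl; omega)
        simpa using this
      have h4 := mul_le_mul_of_nonneg_left h3 hμ0
      push_cast
      linarith
  obtain ⟨w, h1, -, h2, -⟩ := hf' v
  rw [abs_of_pos hxv] at h1
  have h3 := (abs_le.1 h1).2
  have h4 := mul_le_mul_of_nonneg_right h2 hxv.le
  linarith [hgrow (c v) le_rfl]

theorem PathFibration.extrema (hF : PathFibration G D pos c)
    (hosc : ∀ g : V → ℝ, G.lapMatrix ℝ *ᵥ g = lambda2 G • g →
      OscillationBound D pos c (lambda2 G) g)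
    (hμ : lambda2 G ≠ 0) (hf : G.lapMatrix ℝ *ᵥ f = lambda2 G • f) (hne : f ≠ 0) :
    ((∀ v, f v ≤ f (pos 0)) ∧ ∀ v, f (pos D) ≤ f v) ∨
      ((∀ v, f v ≤ f (pos D)) ∧ ∀ v, f (pos 0) ≤ f v) := by
  have main : ∀ g : V → ℝ, G.lapMatrix ℝ *ᵥ g = lambda2 G • g → 0 < g (pos 0) →
      (∀ v, g v ≤ g (pos 0)) ∧ ∀ v, g (pos D) ≤ g v := by
    intro g hg h0
    obtain ⟨h1, h2⟩ := hF.le_apply_zero hosc hμ hg h0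
    have h3 := hF.reverse.le_apply_zero (f := -g) (fun k hk => (hosc k hk).reverse hF) hμ
      (by rw [Matrix.mulVec_neg, hg, smul_neg]) (by simpa using h2)
    exact ⟨h1, fun v => by simpa using h3.1 v⟩
  rcases lt_trichotomy (f (pos 0)) 0 with h | h | h
  · have := main (-f) (by rw [Matrix.mulVec_neg, hf, smul_neg]) (by simpa using h)
    right
    exact ⟨fun v => by simpa using this.2 v, fun v => by simpa using this.1 v⟩
  · exact absurd (hF.eq_zero_of_apply_zero hf (hosc f hf) h) hne
  · exact Or.inl (main f hf h)

end Fibration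

/-! ### The random walk killed on hitting a set. -/

section Hitting

variable {V : Type*}

/-- The trajectories that avoid `S` up to time `n`. -/
def avoiding (S : Set V) (n : ℕ) : Set (ℕ → V) := {ω | ∀ i ≤ n, ω i ∉ S}

/-- A truncation of the tail-sum formula τ = ∑ 1{τ > n}; only this inequality is needed. -/
theorem sum_indicator_avoiding_le (S : Set V) (N : ℕ) (ω : ℕ → V) :
    ∑ n ∈ Finset.range N, (avoiding S n).indicator 1 ω ≤ hittingTime S ω := by
  refine le_iInf fun m => le_iInf fun hm => ?_
  have hzero : ∀ n, m ≤ n → (avoiding S n).indicator (1 : (ℕ → V) → ℝ≥0∞) ω = 0 :=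
    fun n hn => Set.indicator_of_notMem (fun h : ∀ i ≤ n, ω i ∉ S => h m hn hm) _
  calc ∑ n ∈ Finset.range N, (avoiding S n).indicator (1 : (ℕ → V) → ℝ≥0∞) ω
      ≤ ∑ n ∈ Finset.range N, if n < m then 1 else 0 := by
        refine Finset.sum_le_sum fun n _ => ?_
        split_ifs with h
        · exact Set.indicator_le_self' (fun _ _ => zero_le) ω
        · rw [hzero n (not_lt.1 h)]
    _ = (((Finset.range N).filter (· < m)).card : ℝ≥0∞) := by
        rw [Finset.sum_ite]; simp
    _ ≤ m := by
        have : ((Finset.range N).filter (· < m)).card ≤ (Finset.range m).card :=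
          Finset.card_le_card fun i hi => by
            rw [Finset.mem_filter] at hi
            exact Finset.mem_range.2 hi.2
        rw [Finset.card_range] at this
        exact_mod_cast this

variable [Fintype V] [MeasurableSpace V] [MeasurableSingletonClass V] (G : SimpleGraph V) [DecidableRel G.Adj]

instance (v : V) : IsProbabilityMeasure (walkLaw G v) := by
  unfold walkLaw
  infer_instance

theorem measurableSet_avoiding (S : Set V) (n : ℕ) : MeasurableSet (avoiding S n) := by
  have : avoiding S n = ⋂ i ∈ Finset.range (n + 1), (fun ω : ℕ → V => ω i) ⁻¹' Sᶜ := by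
    ext ω
    simp [avoiding]
  rw [this]
  exact Finset.measurableSet_biInter _ fun i _ =>
    (measurable_pi_apply i) (Set.toFinite Sᶜ).measurableSet

theorem measurableSet_eval (n : ℕ) (u : V) : MeasurableSet {ω : ℕ → V | ω n = u} :=
  measurableSet_eq_fun (measurable_pi_apply n) measurable_const

theorem sum_walkLaw_avoiding_le (S : Set V) (v : V) (N : ℕ) :
    ∑ n ∈ Finset.range N, walkLaw G v (avoiding S n) ≤ ∫⁻ ω, hittingTime S ω ∂(walkLaw G v) := by
  calc ∑ n ∈ Finset.range N, walkLaw G v (avoiding S n)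
      = ∑ n ∈ Finset.range N, ∫⁻ ω, (avoiding S n).indicator 1 ω ∂(walkLaw G v) := by
        refine Finset.sum_congr rfl fun n _ => ?_
        rw [lintegral_indicator_one (measurableSet_avoiding S n)]
    _ = ∫⁻ ω, ∑ n ∈ Finset.range N, (avoiding S n).indicator 1 ω ∂(walkLaw G v) :=
        (lintegral_finsetSum _ fun n _ =>
          measurable_one.indicator (measurableSet_avoiding S n)).symm
    _ ≤ _ := lintegral_mono fun ω => sum_indicator_avoiding_le S N ω

/-- The walk started at `v` is at `v` at time `0`. -/
theorem walkLaw_start (v : V) : walkLaw G v {ω | ω 0 = v} = 1 := by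
  have h : (walkLaw G v).map (Preorder.frestrictLe 0) =
      (Measure.dirac v).map (MeasurableEquiv.piUnique
        (fun i : Finset.Iic 0 => (fun _ : ℕ => V) i)).symm := by
    rw [walkLaw, Kernel.trajMeasure, Measure.map_comp _ _ (by fun_prop),
      Kernel.traj_map_frestrictLe, Kernel.partialTraj_self, Measure.id_comp]
  have hT : MeasurableSet {x : (i : Finset.Iic 0) → (fun _ : ℕ => V) i |
      x ⟨0, Finset.mem_Iic.2 le_rfl⟩ = v} :=
    measurableSet_eq_fun (measurable_pi_apply _) measurable_const
  have h2 := congrArg (fun m => m {x : (i : Finset.Iic 0) → (fun _ : ℕ => V) i |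
      x ⟨0, Finset.mem_Iic.2 le_rfl⟩ = v}) h
  simp only at h2
  rw [Measure.map_apply (by fun_prop) hT, Measure.map_apply (by fun_prop) hT,
    Measure.dirac_apply' _ ((by fun_prop : Measurable _) hT)] at h2
  refine Eq.trans h2 (Set.indicator_of_mem ?_ _)
  rfl

/-- The Markov property at a fixed time. -/
theorem walkLaw_step (S : Set V) (v : V) (n : ℕ) (u w : V) :
    walkLaw G v (avoiding S n ∩ {ω | ω n = u} ∩ {ω | ω (n + 1) = w}) =
      walkLaw G v (avoiding S n ∩ {ω | ω n = u}) * stepPMF G u w := by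
  let T : Set ((i : Finset.Iic n) → (fun _ : ℕ => V) i) :=
    {x | (∀ i, x i ∉ S) ∧ x ⟨n, Finset.mem_Iic.2 le_rfl⟩ = u}
  have hT : MeasurableSet T := by
    have : T = (⋂ i, (fun x : (i : Finset.Iic n) → (fun _ : ℕ => V) i => x i) ⁻¹' Sᶜ) ∩
        (fun x => x ⟨n, Finset.mem_Iic.2 le_rfl⟩) ⁻¹' {u} := by
      ext x
      simp [T]
    rw [this]
    exact (MeasurableSet.iInter fun i =>
      (measurable_pi_apply i) (Set.toFinite Sᶜ).measurableSet).inter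
        ((measurable_pi_apply _) (measurableSet_singleton u))
  have hpre : (Preorder.frestrictLe n : (ℕ → V) → _) ⁻¹' T = avoiding S n ∩ {ω | ω n = u} := by
    ext ω
    simp [T, avoiding]
  have h := congrArg (fun m => m (T ×ˢ {w}))
    (Kernel.map_frestrictLe_trajMeasure_compProd_eq_map_trajMeasure
      (X := fun _ => V) (μ₀ := Measure.dirac v) (κ := historyKernel G) (a := n))
  simp only at h
  rw [Measure.compProd_apply_prod hT (measurableSet_singleton w),
    Measure.map_apply (by fun_prop) (hT.prod (measurableSet_singleton w))] at h
  rw [setLIntegral_congr_fun (g := fun _ => stepPMF G u w) hT, setLIntegral_const,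
    Measure.map_apply (by fun_prop) hT, hpre] at h
  · rw [mul_comm]
    refine Eq.trans ?_ h.symm
    rw [← hpre]
    rfl
  · intro x hx
    change (stepPMF G (x ⟨n, Finset.mem_Iic.2 le_rfl⟩)).toMeasure {w} = _
    rw [hx.2, PMF.toMeasure_apply_singleton _ _ (measurableSet_singleton w)]

theorem walkLaw_avoiding_inter_succ (S : Set V) (v : V) (n : ℕ) {w : V} (hw : w ∉ S) :
    walkLaw G v (avoiding S (n + 1) ∩ {ω | ω (n + 1) = w}) =
      ∑ u, walkLaw G v (avoiding S n ∩ {ω | ω n = u}) * stepPMF G u w := by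
  have hset : avoiding S (n + 1) ∩ {ω | ω (n + 1) = w} =
      ⋃ u ∈ Finset.univ, (avoiding S n ∩ {ω | ω n = u} ∩ {ω | ω (n + 1) = w}) := by
    ext ω
    simp only [avoiding, Set.mem_inter_iff, Set.mem_ofPred_eq, Set.mem_iUnion, Finset.mem_univ,
      exists_prop, true_and]
    constructor
    · rintro ⟨h1, h2⟩
      exact ⟨ω n, ⟨fun i hi => h1 i (by omega), rfl⟩, h2⟩
    · rintro ⟨u, ⟨h1, -⟩, h2⟩
      refine ⟨fun i hi => ?_, h2⟩
      rcases Nat.lt_or_ge i (n + 1) with h3 | h3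
      · exact h1 i (by omega)
      · rw [le_antisymm hi h3, h2]; exact hw
  rw [hset, measure_biUnion_finset]
  · exact Finset.sum_congr rfl fun u _ => walkLaw_step G S v n u w
  · intro u _ u' _ huu'
    refine Set.disjoint_left.2 fun ω h1 h2 => huu' ?_
    exact h1.1.2.symm.trans h2.1.2
  · exact fun u _ => ((measurableSet_avoiding S n).inter (measurableSet_eval n u)).inter
      (measurableSet_eval (n + 1) w)

theorem sum_walkLaw_avoiding_inter (S : Set V) (v : V) (n : ℕ) :
    ∑ u, walkLaw G v (avoiding S n ∩ {ω | ω n = u}) = walkLaw G v (avoiding S n) := by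
  rw [← measure_biUnion_finset]
  · congr 1
    ext ω
    simp
  · intro u _ u' _ huu'
    exact Set.disjoint_left.2 fun ω h1 h2 => huu' (h1.2.symm.trans h2.2)
  · exact fun u _ => (measurableSet_avoiding S n).inter (measurableSet_eval n u)

theorem walkLaw_avoiding_zero {S : Set V} {v : V} (hv : v ∉ S) :
    walkLaw G v (avoiding S 0 ∩ {ω | ω 0 = v}) = 1 := by
  rw [← walkLaw_start G v]
  congr 1
  ext ω
  simp only [avoiding, Nat.le_zero, forall_eq, Set.mem_inter_iff, Set.mem_ofPred_eq,
    and_iff_right_iff_imp]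
  rintro rfl
  exact hv

open Classical in
/-- If `ψ` exceeds the mean of its values after one step of the walk killed on `S` by at most `C`,
then `ψ` is at most `C` times the expected hitting time of `S`. -/
theorem le_mul_of_lintegral_hittingTime_le {S : Set V} {ψ : V → ℝ} {C H : ℝ} (hC : 0 ≤ C)
    (hH : 0 ≤ H)
    (hψ : ∀ u, u ∉ S → ψ u ≤ (∑ w, if w ∈ S then 0 else (stepPMF G u w).toReal * ψ w) + C)
    {v : V} (hv : v ∉ S) (hhit : ∫⁻ ω, hittingTime S ω ∂(walkLaw G v) ≤ ENNReal.ofReal H) :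
    ψ v ≤ C * H := by
  -- `q n` is the law at time n of the walk killed on `S`, and `e n` its surviving mass. The masses
  -- have partial sums at most `H`, so they tend to 0.
  let q : ℕ → V → ℝ := fun n u => (walkLaw G v (avoiding S n ∩ {ω | ω n = u})).toReal
  let e : ℕ → ℝ := fun n => (walkLaw G v (avoiding S n)).toReal
  have hq0 : ∀ n u, 0 ≤ q n u := fun n u => ENNReal.toReal_nonneg
  have he : ∀ n, ∑ u, q n u = e n := by
    intro n
    simp only [q, e]
    rw [← sum_walkLaw_avoiding_inter G S v n, ENNReal.toReal_sum fun u _ => measure_ne_top _ _]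
  have hqS : ∀ n u, u ∈ S → q n u = 0 := by
    intro n u hu
    have : avoiding S n ∩ {ω : ℕ → V | ω n = u} = ∅ := by
      ext ω
      simp only [avoiding, Set.mem_inter_iff, Set.mem_ofPred_eq, Set.mem_empty_iff_false,
        iff_false, not_and]
      rintro h rfl
      exact h n le_rfl hu
    simp [q, this]
  have hstep : ∀ n w, w ∉ S → q (n + 1) w = ∑ u, q n u * (stepPMF G u w).toReal := by
    intro n w hw
    simp only [q]
    rw [walkLaw_avoiding_inter_succ G S v n hw, ENNReal.toReal_sum fun u _ =>
      ENNReal.mul_ne_top (measure_ne_top _ _) (PMF.apply_ne_top _ _)]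
    simp only [ENNReal.toReal_mul]
  have hsum : ∀ N, ∑ n ∈ Finset.range N, e n ≤ H := by
    intro N
    have h1 := (sum_walkLaw_avoiding_le G S v N).trans hhit
    have h2 := ENNReal.toReal_mono ENNReal.ofReal_ne_top h1
    rwa [ENNReal.toReal_sum fun n _ => measure_ne_top _ _, ENNReal.toReal_ofReal hH] at h2
  have hlim : Filter.Tendsto e Filter.atTop (nhds 0) :=
    (summable_of_sum_range_le (fun n => ENNReal.toReal_nonneg) hsum).tendsto_atTop_zero
  have hmono : ∀ n, ∑ u, q n u * ψ u ≤ ∑ u, q (n + 1) u * ψ u + C * e n := by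
    intro n
    have h1 : ∑ w, q (n + 1) w * ψ w =
        ∑ u, q n u * ∑ w, if w ∈ S then 0 else (stepPMF G u w).toReal * ψ w := by
      simp only [Finset.mul_sum]
      rw [Finset.sum_comm]
      refine Finset.sum_congr rfl fun w _ => ?_
      split_ifs with hw
      · simp [hqS (n + 1) w hw]
      · rw [hstep n w hw, Finset.sum_mul]
        exact Finset.sum_congr rfl fun u _ => by ring
    rw [h1, ← he, Finset.mul_sum, ← Finset.sum_add_distrib]
    refine Finset.sum_le_sum fun u _ => ?_
    by_cases hu : u ∈ S
    · simp [hqS n u hu]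
    · have := mul_le_mul_of_nonneg_left (hψ u hu) (hq0 n u)
      linarith
  -- Each step costs at most `C` per unit of surviving mass. As N grows, the terminal term vanishes
  -- and the total cost is at most `C * H`.
  have htel : ∀ N, ∑ u, q 0 u * ψ u ≤
      ∑ u, q N u * ψ u + C * ∑ n ∈ Finset.range N, e n := by
    intro N
    induction N with
    | zero => simp
    | succ N ih =>
      rw [Finset.sum_range_succ, mul_add]
      linarith [hmono N]
  have hstart : ∑ u, q 0 u * ψ u = ψ v := by
    have h1 : q 0 v = 1 := by simp [q, walkLaw_avoiding_zero G hv]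
    rw [Finset.sum_eq_single v, h1, one_mul]
    · intro u _ hu
      have hle : e 0 ≤ 1 := ENNReal.toReal_le_of_le_ofReal zero_le_one
        (by simpa using prob_le_one)
      have h2 : q 0 u + q 0 v ≤ e 0 := by
        rw [← he 0, ← Finset.sum_pair hu]
        exact Finset.sum_le_sum_of_subset_of_nonneg (Finset.subset_univ _) fun _ _ _ => hq0 _ _
      have : q 0 u = 0 := le_antisymm (by linarith) (hq0 _ _)
      rw [this, zero_mul]
    · intro h; exact absurd (Finset.mem_univ v) h
  have hbound : ∀ N, ψ v ≤ e N * (∑ u, |ψ u|) + C * H := by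
    intro N
    have h1 : ∑ u, q N u * ψ u ≤ e N * ∑ u, |ψ u| := by
      rw [Finset.mul_sum]
      refine Finset.sum_le_sum fun u _ => ?_
      have h2 : q N u ≤ e N := by
        rw [← he N]
        exact Finset.single_le_sum (fun u _ => hq0 N u) (Finset.mem_univ u)
      exact (mul_le_mul_of_nonneg_left (le_abs_self _) (hq0 N u)).trans
        (mul_le_mul_of_nonneg_right h2 (abs_nonneg _))
    have h2 := mul_le_mul_of_nonneg_left (hsum N) hC
    linarith [htel N]
  have h3 := (hlim.mul_const (∑ u, |ψ u|)).add_const (C * H)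
  rw [zero_mul, zero_add] at h3
  exact ge_of_tendsto' h3 hbound

end Hitting

theorem one_le_expectedHit {V : Type*} [Fintype V] (G : SimpleGraph V) [DecidableRel G.Adj] {S : Set V} {v : V} (hv : v ∉ S) : 1 ≤ expectedHit G S v := by
  let _ : MeasurableSpace V := ⊤
  have h1 := sum_walkLaw_avoiding_le G S v 1
  rw [Finset.sum_range_one] at h1
  refine le_trans ?_ h1
  rw [← walkLaw_avoiding_zero G hv]
  exact measure_mono Set.inter_subset_left

theorem stepPMF_toReal {V : Type*} [Fintype V] (G : SimpleGraph V) [DecidableRel G.Adj] {u : V}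
    (hu : 0 < G.degree u) (w : V) :
    (stepPMF G u w).toReal = if G.Adj u w then (G.degree u : ℝ)⁻¹ else 0 := by
  have h : (G.neighborFinset u).Nonempty := Finset.card_pos.1 hu
  rw [stepPMF, dif_pos h, PMF.uniformOfFinset_apply]
  by_cases hw : G.Adj u w
  · simp [hw]
  · simp [hw]

/-! ### From hitting times to the oscillation of eigenfunctions. -/

section Oscillation

variable {V : Type*} [Fintype V] [DecidableEq V] {G : SimpleGraph V} [DecidableRel G.Adj]
  {D : ℕ} {pos : ℕ → V} {c : V → ℕ} {μ : ℝ} {f : V → ℝ} {S : Set V}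

/-- On a cluster, an eigenfunction exceeds its value at the path vertex by at most the eigenvalue
times its maximum modulus times the maximal expected hitting time. -/
theorem PathFibration.sub_le_of_expectedHit_le (hF : PathFibration G D pos c)
    (hS : ∀ v, v ∈ S ↔ v = pos (c v)) (hdeg : ∀ v, 0 < G.degree v)
    (hμ : 0 ≤ μ) (hf : G.lapMatrix ℝ *ᵥ f = μ • f) {k : ℕ} {M H : ℝ} (hM : 0 ≤ M) (hH : 0 ≤ H)
    (hfM : ∀ v, v ∉ S → c v = k → f v ≤ M) {v : V} (hv : v ∉ S) (hvk : c v = k)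
    (hhit : expectedHit G S v ≤ ENNReal.ofReal H) :
    f v - f (pos k) ≤ μ * M * H := by
  classical
  let _ : MeasurableSpace V := ⊤
  have hnbr : ∀ u, u ∉ S → ∀ w, G.Adj u w → c w = c u := by
    intro u hu w h
    rcases hF.adj u w h with h1 | ⟨h1, -⟩
    · exact h1.symm
    · exact absurd ((hS u).2 h1) hu
  -- The walk cannot change cluster before hitting `S`, so extending by 0 to the other clusters is
  -- harmless. At its own path vertex the difference is 0, matching the killing.
  have key := le_mul_of_lintegral_hittingTime_le G (S := S)
    (ψ := fun u => if c u = k then f u - f (pos k) else 0) (C := μ * M) (H := H)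
    (mul_nonneg hμ hM) hH ?_ hv hhit
  · simpa [hvk] using key
  · intro u hu
    by_cases huk : c u = k
    · have hd : (1 : ℝ) ≤ G.degree u := by exact_mod_cast hdeg u
      have hd0 : (0 : ℝ) < G.degree u := by linarith
      have hterm : ∀ w, (if w ∈ S then 0 else (stepPMF G u w).toReal *
          if c w = k then f w - f (pos k) else 0) =
          (G.degree u : ℝ)⁻¹ * if G.Adj u w then f w - f (pos k) else 0 := by
        intro w
        rw [stepPMF_toReal G (hdeg u)]
        by_cases h : G.Adj u w
        · have hw := (hnbr u hu w h).trans huk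
          by_cases hwS : w ∈ S
          · have := (hS w).1 hwS
            rw [hw] at this
            simp [this]
          · simp [hwS, h, hw]
        · simp [h]
      have heq := congrFun hf u
      rw [lapMatrix_mulVec_eq_sum, Pi.smul_apply, smul_eq_mul] at heq
      have hsplit : (∑ w, if G.Adj u w then f u - f w else 0) =
          G.degree u * (f u - f (pos k)) - ∑ w, if G.Adj u w then f w - f (pos k) else 0 := by
        rw [SimpleGraph.degree_eq_sum_if_adj, Finset.sum_mul, ← Finset.sum_sub_distrib]
        refine Finset.sum_congr rfl fun w _ => ?_
        split_ifs <;> ring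
      rw [hsplit] at heq
      simp only [huk, if_true]
      rw [Finset.sum_congr rfl fun w _ => hterm w, ← Finset.mul_sum]
      set T := ∑ w, if G.Adj u w then f w - f (pos k) else 0
      have h1 : f u - f (pos k) = (G.degree u : ℝ)⁻¹ * T + (G.degree u : ℝ)⁻¹ * (μ * f u) := by
        field_simp
        linarith
      have h2 : (G.degree u : ℝ)⁻¹ * (μ * f u) ≤ (G.degree u : ℝ)⁻¹ * (μ * M) :=
        mul_le_mul_of_nonneg_left (mul_le_mul_of_nonneg_left (hfM u hu huk) hμ) (by positivity)
      have h3 : (G.degree u : ℝ)⁻¹ * (μ * M) ≤ 1 * (μ * M) :=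
        mul_le_mul_of_nonneg_right (inv_le_one_of_one_le₀ hd) (mul_nonneg hμ hM)
      linarith
    · have hzero : (∑ w, if w ∈ S then 0 else (stepPMF G u w).toReal *
          if c w = k then f w - f (pos k) else 0) = 0 := by
        refine Finset.sum_eq_zero fun w _ => ?_
        rw [stepPMF_toReal G (hdeg u)]
        by_cases h : G.Adj u w
        · have hw : c w ≠ k := by rw [hnbr u hu w h]; exact huk
          simp [hw]
        · simp [h]
      rw [hzero]
      simp only [huk, if_false, zero_add]
      exact mul_nonneg hμ hM

/-- The one-sided bound for f and -f involves the maximum of |f| over the cluster; smallness of `μ *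
H` absorbs it into |f| at the path vertex. -/
theorem PathFibration.abs_sub_le_of_expectedHit_le (hF : PathFibration G D pos c)
    (hS : ∀ v, v ∈ S ↔ v = pos (c v)) (hdeg : ∀ v, 0 < G.degree v)
    (hμ : 0 ≤ μ) (hf : G.lapMatrix ℝ *ᵥ f = μ • f) {k : ℕ} {H : ℝ} (hH : 0 ≤ H)
    (hμH : μ * H ≤ 1 / 4)
    (hhit : ∀ v, v ∉ S → c v = k → expectedHit G S v ≤ ENNReal.ofReal H)
    {v : V} (hv : v ∉ S) (hvk : c v = k) :
    |f v - f (pos k)| ≤ 2 * (μ * H) * |f (pos k)| := by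
  classical
  obtain ⟨m, hm, hmax⟩ := Finset.exists_max_image
    (Finset.univ.filter fun u => u ∉ S ∧ c u = k) (fun u => |f u|) ⟨v, by simp [hv, hvk]⟩
  simp only [Finset.mem_filter, Finset.mem_univ, true_and] at hm hmax
  have hbound : ∀ u, u ∉ S → c u = k → |f u - f (pos k)| ≤ μ * |f m| * H := by
    intro u hu huk
    have h1 := hF.sub_le_of_expectedHit_le hS hdeg hμ hf (k := k) (abs_nonneg (f m)) hH
      (fun w hw hwk => (le_abs_self _).trans (hmax w ⟨hw, hwk⟩)) hu huk (hhit u hu huk)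
    have h2 := hF.sub_le_of_expectedHit_le (f := -f) hS hdeg hμ
      (by rw [Matrix.mulVec_neg, hf, smul_neg]) (k := k) (abs_nonneg (f m)) hH
      (fun w hw hwk => (neg_le_abs _).trans (hmax w ⟨hw, hwk⟩)) hu huk (hhit u hu huk)
    simp only [Pi.neg_apply] at h2
    exact abs_le.2 ⟨by linarith, h1⟩
  have h1 := hbound m hm.1 hm.2
  have h2 : |f m| ≤ 2 * |f (pos k)| := by
    have h3 : |f m| ≤ |f m - f (pos k)| + |f (pos k)| := by
      simpa using abs_add_le (f m - f (pos k)) (f (pos k))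
    have h4 := mul_le_mul_of_nonneg_right hμH (abs_nonneg (f m))
    have h5 := abs_nonneg (f m)
    linarith
  have h3 := mul_le_mul_of_nonneg_left h2 (mul_nonneg hμ hH)
  linarith [hbound v hv hvk]

end Oscillation

theorem one_le_of_one_le_sq {k : ℕ} {H : ℝ} (h1 : 1 ≤ H) (h2 : H ≤ 1 / 50 * ((k : ℝ) + 1) ^ 2) :
    (1 : ℝ) ≤ k := by
  rcases k with _ | k
  · norm_num at h2; linarith
  · push_cast; linarith [k.cast_nonneg (α := ℝ)]

theorem PathFibration.oscillationBound {V : Type*} [Fintype V] [DecidableEq V] [Nontrivial V]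
    {G : SimpleGraph V} [DecidableRel G.Adj] {D : ℕ} {pos : ℕ → V} {c : V → ℕ} {f : V → ℝ}
    {S : Set V} (hF : PathFibration G D pos c) (hD : 0 < D)
    (hS : ∀ v, v ∈ S ↔ v = pos (c v)) (hdeg : ∀ v, 0 < G.degree v)
    (η : ℕ → ℝ) (hη : ∀ k, 0 ≤ η k)
    (hηl : ∀ k ≤ D, η k ≤ 1 / 50 * ((k : ℝ) + 1) ^ 2)
    (hηr : ∀ k ≤ D, η k ≤ 1 / 50 * ((D : ℝ) - k + 1) ^ 2)
    (hhit : ∀ v, v ∉ S → expectedHit G S v ≤ ENNReal.ofReal (η (c v)))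
    (hf : G.lapMatrix ℝ *ᵥ f = lambda2 G • f) :
    OscillationBound D pos c (lambda2 G) f := by
  intro v
  have hμ := lambda2_nonneg G
  have hk := hF.proj_le v
  have hkD : (c v : ℝ) ≤ D := by exact_mod_cast hk
  have hk0 : (0 : ℝ) ≤ c v := Nat.cast_nonneg _
  by_cases hv : v ∈ S
  · refine ⟨0, ?_, by norm_num, by positivity, ?_⟩
    · rw [← (hS v).1 hv]; simp
    · exact mul_nonneg hμ (div_nonneg (mul_nonneg (by linarith) (by linarith)) zero_le_two)
  · have hl := hηl (c v) hk
    have hr := hηr (c v) hk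
    -- Leaving an off-path vertex takes at least one step, so nonempty attachments force `η` to be
    -- at least 1. This keeps them away from both ends and absorbs the shift by one in `hηl` and
    -- `hηr`.
    have h1 : 1 ≤ η (c v) := by
      have := (one_le_expectedHit G hv).trans (hhit v hv)
      rwa [ENNReal.one_le_ofReal] at this
    have hk1 := one_le_of_one_le_sq h1 hl
    have hk2 : (1 : ℝ) ≤ (D : ℝ) - c v := by
      rw [← Nat.cast_sub hk] at hr ⊢
      exact one_le_of_one_le_sq h1 hr
    -- The smaller of k+1 and D-k+1 is at most (D+2)/2, and D+2 ≤ 2(D+1). Then λ₂η ≤ 12/100.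
    have hsq : η (c v) ≤ ((D : ℝ) + 1) * (D + 2) / 100 := by
      rcases le_total ((c v : ℝ) + 1) ((D : ℝ) - c v + 1) with h | h <;> nlinarith
    have hμη : lambda2 G * η (c v) ≤ 1 / 4 := by
      have h3 := mul_le_mul_of_nonneg_left hsq hμ
      have h4 := hF.lambda2_le hD
      linarith
    refine ⟨2 * (lambda2 G * η (c v)), ?_, by linarith, ?_, ?_⟩
    · exact hF.abs_sub_le_of_expectedHit_le hS hdeg hμ hf (hη _) hμη
        (fun u hu huk => by rw [← huk]; exact hhit u hu) hv rfl
    · have : 2 * η (c v) ≤ (c v : ℝ) * (c v + 1) / 2 := by nlinarith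
      linarith [mul_le_mul_of_nonneg_left this hμ]
    · have : 2 * η (c v) ≤ ((D : ℝ) - c v) * ((D : ℝ) - c v + 1) / 2 := by nlinarith
      linarith [mul_le_mul_of_nonneg_left this hμ]

/-! ### Attached graphs give a fibration over the path. -/

/-- Adjacent vertices of a geodesic are consecutive. -/
theorem le_succ_of_adj_getVert {V : Type*} {G : SimpleGraph V} (hG : G.Connected) {a b : V}
    (p : G.Walk a b) (hdist : p.length = G.dist a b) {i j : ℕ} (hi : i ≤ p.length)
    (hj : j ≤ p.length) (h : G.Adj (p.getVert i) (p.getVert j)) : j ≤ i + 1 := by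
  have h1 : G.dist a (p.getVert i) ≤ i := by
    simpa [SimpleGraph.Walk.take_length, hi] using SimpleGraph.dist_le (p.take i)
  have h2 : G.dist (p.getVert j) b ≤ p.length - j := by
    simpa [SimpleGraph.Walk.drop_length] using SimpleGraph.dist_le (p.drop j)
  have h3 := hG.dist_triangle (u := a) (v := p.getVert i) (w := b)
  have h4 := hG.dist_triangle (u := p.getVert i) (v := p.getVert j) (w := b)
  rw [SimpleGraph.dist_eq_one_iff_adj.2 h] at h4
  omega

/-- A path with attached graphs fibres the graph over the path. -/
theorem AttachedGraphs.exists_pathFibration {V : Type*} {G : SimpleGraph V} (hG : G.Connected)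
    {a b : V} {p : G.Walk a b} (hp : p.IsPath) (hdist : p.length = G.dist a b)
    {ι : Fin (p.length + 1) → Type*} {A : ∀ k, ι k → Finset V} (hA : AttachedGraphs G p A) :
    ∃ c : V → ℕ, PathFibration G p.length p.getVert c ∧
      (∀ v, v ∈ p.support ↔ v = p.getVert (c v)) ∧
      ∀ v, v ∉ p.support → ∃ (k : Fin (p.length + 1)) (i : ι k), v ∈ A k i ∧ c v = k := by
  have hex : ∀ v, ∃ n : ℕ, n ≤ p.length ∧ (v ∈ p.support → v = p.getVert n) ∧
      (v ∉ p.support → ∃ (k : Fin (p.length + 1)) (i : ι k), v ∈ A k i ∧ n = k) := by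
    intro v
    by_cases hv : v ∈ p.support
    · obtain ⟨n, hn, hle⟩ := SimpleGraph.Walk.mem_support_iff_exists_getVert.1 hv
      exact ⟨n, hle, fun _ => hn.symm, fun h => absurd hv h⟩
    · obtain ⟨k, i, hki⟩ := hA.cover v hv
      exact ⟨k, Nat.lt_succ_iff.1 k.isLt, fun h => absurd h hv, fun _ => ⟨k, i, hki, rfl⟩⟩
  choose c hcle hcon hcoff using hex
  have hpos : ∀ k ≤ p.length, c (p.getVert k) = k := fun k hk =>
    (hp.getVert_injOn hk (hcle _) (hcon _ (p.getVert_mem_support k))).symm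
  have hoff : ∀ u w, u ∉ p.support → G.Adj u w → c u = c w := by
    intro u w hu h
    obtain ⟨k, i, hki, hck⟩ := hcoff u hu
    rw [hck]
    by_cases hw : w ∈ A k i
    · obtain ⟨k', i', hki', hck'⟩ := hcoff w (hA.off_path k i w hw)
      rw [hck']
      by_contra hne
      have := hA.disjoint (i := ⟨k, i⟩) (j := ⟨k', i'⟩) fun heq =>
        hne (congrArg (fun x : (Σ k, ι k) => (x.1 : ℕ)) heq)
      exact Finset.disjoint_left.1 this hw hki'
    · have h1 := hA.isolated k i u hki w hw h.toWalk (by simp [h.ne])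
      simp only [SimpleGraph.Walk.support_cons, SimpleGraph.Walk.support_nil, List.mem_cons,
        List.not_mem_nil, or_false] at h1
      rcases h1 with h1 | h1
      · exact absurd (h1 ▸ p.getVert_mem_support k) hu
      · rw [← h1, hpos k (Nat.lt_succ_iff.1 k.isLt)]
  refine ⟨c, ⟨hpos, hcle, ?_, fun k hk => p.adj_getVert_succ hk⟩, fun v => ⟨hcon v, fun h => ?_⟩,
    hcoff⟩
  · intro u w h
    by_cases hu : u ∈ p.support
    · by_cases hw : w ∈ p.support
      · right
        have hu' := hcon u hu
        have hw' := hcon w hw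
        rw [hu', hw'] at h
        have h1 := le_succ_of_adj_getVert hG p hdist (hcle u) (hcle w) h
        have h2 := le_succ_of_adj_getVert hG p hdist (hcle w) (hcle u) h.symm
        have h3 : c u ≠ c w := fun heq => h.ne (by rw [heq])
        exact ⟨hu', hw', by omega⟩
      · exact Or.inl (hoff w u hw h.symm).symm
    · exact Or.inl (hoff u w hu h)
  · rw [h]; exact p.getVert_mem_support _

end FiedlerPath

theorem theorem2 {V : Type*} [Fintype V] [DecidableEq V] [Nontrivial V]
    (G : SimpleGraph V) [DecidableRel G.Adj] (hG : G.Connected)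
    -- a path `p` of length `diam(G)` joining two vertices at distance `diam(G)`
    {a b : V} (p : G.Walk a b) (hp : p.IsPath)
    (hlen : p.length = G.diam) (hdist : G.dist a b = G.diam)
    -- the attached graphs
    {ι : Fin (p.length + 1) → Type*} (A : ∀ k, ι k → Finset V)
    (hA : FiedlerPath.AttachedGraphs G p A)
    -- the path vertices are labelled consecutively, starting either from `0` or from `1`
    (s : ℕ) (hs : s = 0 ∨ s = 1)
    (hcard : ∀ k i, ((A k i).card : ℝ) ≤ (G.diam : ℝ) / 32)
    (hhit : ∀ k i, FiedlerPath.maxHit G {v | v ∈ p.support} (A k i) ≤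
      ENNReal.ofReal (1 / 50 * (min ((k : ℕ) + s : ℝ) (G.diam - ((k : ℕ) + s : ℝ))) ^ 2))
    (φ : V → ℝ) (hφ : FiedlerPath.IsFiedlerVector G φ) :
    ((∀ v, φ v ≤ φ a) ∧ (∀ v, φ b ≤ φ v)) ∨ ((∀ v, φ v ≤ φ b) ∧ (∀ v, φ a ≤ φ v)) := by
  obtain ⟨hne, hφ⟩ := hφ
  -- If λ₂ = 0, eigenvectors are constant by connectedness and the claim is trivial.
  by_cases hμ : FiedlerPath.lambda2 G = 0
  · rw [hμ, zero_smul, SimpleGraph.lapMatrix_mulVec_eq_zero_iff_forall_reachable] at hφ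
    exact Or.inl ⟨fun v => (hφ v a (hG.preconnected v a)).le,
      fun v => (hφ b v (hG.preconnected b v)).le⟩
  obtain ⟨c, hF, hS, hoff⟩ := hA.exists_pathFibration hG hp (hlen.trans hdist.symm)
  have hD : 0 < p.length := by
    obtain ⟨x, y, hxy⟩ := exists_pair_ne V
    have h1 := hG.pos_dist_of_ne hxy
    have h2 := SimpleGraph.dist_le_diam (SimpleGraph.connected_iff_ediam_ne_top.1 hG)
      (u := x) (v := y)
    omega
  have hs0 : (0 : ℝ) ≤ s := Nat.cast_nonneg _
  have hs1 : (s : ℝ) ≤ 1 := by rcases hs with rfl | rfl <;> norm_num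
  have hext := hF.extrema (f := φ) (fun g hg => hF.oscillationBound
    (S := {v | v ∈ p.support}) hD hS (fun v => hG.preconnected.degree_pos_of_nontrivial v)
    (fun k => 1 / 50 * (min ((k : ℕ) + s : ℝ) (G.diam - ((k : ℕ) + s : ℝ))) ^ 2)
    (fun k => by positivity) ?_ ?_ ?_ hg) hμ hφ hne
  · simpa using hext
  · intro k hk
    have hk' : (k : ℝ) ≤ G.diam := by rw [← hlen]; exact_mod_cast hk
    have hk0 : (0 : ℝ) ≤ k := Nat.cast_nonneg _
    -- The lower bound on the minimum matters: at k = D with s = 1 the second entry is -1, whose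
    -- square is 1, not 0. The bound with k+1 covers both labellings.
    refine mul_le_mul_of_nonneg_left (sq_le_sq' (le_min ?_ ?_) (min_le_of_left_le ?_))
      (by norm_num) <;> linarith
  · intro k hk
    have hk' : (k : ℝ) ≤ G.diam := by rw [← hlen]; exact_mod_cast hk
    have hk0 : (0 : ℝ) ≤ k := Nat.cast_nonneg _
    rw [hlen]
    refine mul_le_mul_of_nonneg_left (sq_le_sq' (le_min ?_ ?_) (min_le_of_right_le ?_))
      (by norm_num) <;> linarith
  · intro v hv
    obtain ⟨k, i, hki, hck⟩ := hoff v hv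
    rw [hck]
    exact (le_iSup₂ (f := fun v (_ : v ∈ A k i) =>
      FiedlerPath.expectedHit G {v | v ∈ p.support} v) v hki).trans (hhit k i)
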